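/- **Setting.** A shortest-path problem consists of a finite directed graph $\mathcal G=(\mathcal V,\mathcal E)$, a lazy estimate $\hat w:\mathcal E\to\mathbb R_{>0}$, a true cost $w$ with $w(e)=\hat w(e)$ if $e$ is not in collision and $w(e)=\infty$ if $e$ is in collision, and vertices $v_{\rm source},v_{\rm target}$. Assume that no two distinct simple paths starting at $v_{\rm source}$ have the same lazy cost $\hat w(P)=\sum_{e\in P}\hat w(e)$. **The algorithm.** LRA* with lookahead $\alpha$ and greediness $\beta$ ($\alpha,\beta\in\{1,2,\dots\}\cup\{\infty\}$) maintains a search tree $\mathcal T$ rooted at $v_{\rm source}$, with at most one node $\tau$ per vertex $u[\tau]$. A node stores its parent, the true cost $c[\tau]$ of the evaluated initial portion (head) of its tree path $P[\tau]$, the lazy cost $\ell[\tau]$ of the remaining, not yet evaluated portion $P[\tau]_{\rm tail}$, and its budget $b[\tau]$, the number of edges of $P[\tau]_{\rm tail}$. The key of $\tau$ is $c[\tau]+\ell[\tau]$. Initially $\mathcal T$ consists of the root with $c=\ell=b=0$. * *Extending.* As long as some node $\tau$ with $u[\tau]=p\neq v_{\rm target}$ and $b[\tau]<\alpha$ and some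 edge $(p,v)$ of the current graph are such that $v$ has no node, or a node of key larger than $c[\tau]+\ell[\tau]+\hat w(p,v)$, take such a pair for which $c[\tau]+\ell[\tau]+\hat w(p,v)$ is minimal, remove the present node of $v$ (if any) with its subtree, and insert the node of $v$ with parent $\tau$ and entries $c[\tau]$, $\ell[\tau]+\hat w(p,v)$, $b[\tau]+1$. * *Evaluating.* When $\mathcal T$ is fully extended, let $\tau$ be the node of minimal key among those with $b[\tau]=\alpha$ or $u[\tau]=v_{\rm target}$ (if there is none, the algorithm stops with failure). Evaluate the first $\beta$ edges of $P[\tau]_{\rm tail}$ (all of them if there are fewer) in order. If the evaluated edge $(u,v)$ is collision-free, the entries of the node of $v$ and of its descendants are updated (this edge moves from the tails of their paths to the heads), and if moreover $v=v_{\rm target}$, the algorithm stops and returns the path found. If $(u,v)$ is in collision, the evaluation of the path ends, the edge is removed from the graph, and the nodes of the subtree rooted at the node of $v$ are removed from $\mathcal T$ and then rewired, in the order of their keys, each to its best parent in $\mathcal T$, that is, one that minimizes the key, among the nodes of budget $<\alpha$ other than that of $v_{\rm target}$ (nodes without such a parent stay out of $\mathcal T$). Then $\mathcal T$ is extended again,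 and so on. Let $E_x$ be the set of edges evaluated by LRA* with lookahead $\alpha$ and greediness $x$. **Lemma.** For every shortest-path problem as above and all $\alpha\ge\beta>1$ (the value $\infty$ being allowed for $\alpha$ and $\beta$), $E_1\subseteq E_\beta$. -/

import Mathlib

/-- A shortest-path problem: a directed graph, a positive lazy estimate `lazyCost` of the edge
costs, the set of edges that are in collision, a source and a target vertex. -/
structure SPProblem (V : Type*) where
  graph : Digraph V
  lazyCost : V → V → ℝ
  lazyCost_pos : ∀ u v, graph.Adj u v → 0 < lazyCost u v
  inCollision : V → V → Prop
  source : V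
  target : V

namespace SPProblem

variable {V : Type*}

open Classical in
/-- The true cost `w` of an edge: the lazy estimate if the edge is not in collision, and `∞` if
it is. -/
noncomputable def trueCost (P : SPProblem V) (u v : V) : EReal :=
  if P.inCollision u v then ⊤ else (P.lazyCost u v : EReal)

/-- The lazy cost of the path through the listed vertices: the sum of the lazy estimates of its
edges. -/
def lazyPathCost (P : SPProblem V) (l : List V) : ℝ :=
  (List.zipWith P.lazyCost l l.tail).sum

/-- `l` lists the vertices of a simple path of the graph that starts at the source. -/
def IsSimplePathFromSource (P : SPProblem V) (l : List V) : Prop :=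
  l.head? = some P.source ∧ l.IsChain P.graph.Adj ∧ l.Nodup

/-- No two distinct simple paths from the source have the same (lazy) weight. -/
def NoTies (P : SPProblem V) : Prop :=
  ∀ l₁ l₂ : List V, P.IsSimplePathFromSource l₁ → P.IsSimplePathFromSource l₂ →
    P.lazyPathCost l₁ = P.lazyPathCost l₂ → l₁ = l₂

end SPProblem

/-- The entry `(p, c, ℓ, b)` of the search-tree node of a vertex: the parent (`none` at the root),
the cost of the evaluated portion of the path to the node, the lazy cost of its lazily evaluated
portion, and the budget, which is the number of edges of the latter. -/
structure LRANode (V : Type*) where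
  parent : Option V
  cost : ℝ
  lcost : ℝ
  budget : ℕ

/-- The key of a node: the estimated total cost of the path to it. -/
def LRANode.key {V : Type*} (τ : LRANode V) : ℝ := τ.cost + τ.lcost

/-- A state of LRA*. -/
structure LRAState (V : Type*) where
  /-- the search tree, with at most one node for each vertex -/
  tree : V → Option (LRANode V)
  /-- the edges of the current graph, from which edges found to be in collision are removed -/
  edges : Set (V × V)
  /-- the edges that have been evaluated so far -/
  evaluated : Set (V × V)
  /-- the vertices whose nodes are waiting to be rewired -/
  pending : Set V
  /-- whether a path to the target has been returned -/
  finished : Prop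

namespace LRAState

variable {V : Type*}

/-- The node of `u` is the parent of the node of `v` in the search tree. -/
def IsParent (T : V → Option (LRANode V)) (u v : V) : Prop :=
  ∃ τ, T v = some τ ∧ τ.parent = some u

/-- The vertices of the subtree of the search tree that is rooted at `v`, including `v`. -/
def subtree (T : V → Option (LRANode V)) (v : V) : Set V :=
  {x | Relation.ReflTransGen (IsParent T) v x}

open Classical in
/-- Remove the nodes of the vertices in `S` from the tree. -/
noncomputable def removeNodes (T : V → Option (LRANode V)) (S : Set V) :
    V → Option (LRANode V) :=
  fun x => if x ∈ S then none else T x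

/-- The last `k` edges of the path to `v` in the tree, found by backtracking parents. -/
def lastEdges (T : V → Option (LRANode V)) : ℕ → V → List (V × V)
  | 0, _ => []
  | k + 1, v =>
    match (T v).bind LRANode.parent with
    | none => []
    | some p => lastEdges T k p ++ [(p, v)]

/-- The lazily evaluated tail of the path to `v` in the tree, as a list of edges. -/
def tail (T : V → Option (LRANode V)) (v : V) : List (V × V) :=
  match T v with
  | none => []
  | some τ => lastEdges T τ.budget v

/-- The initial state: the tree consists of the root, and nothing is evaluated. -/
noncomputable def init (P : SPProblem V) : LRAState V where
  tree := open Classical in fun x => if x = P.source then some ⟨none, 0, 0, 0⟩ else none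
  edges := {e | P.graph.Adj e.1 e.2}
  evaluated := ∅
  pending := ∅
  finished := False

/-! ### Rewiring and extending the `α`-band -/

/-- The child node that a tree node `τ` of the vertex `p` generates for the vertex `v`, over an
edge `(p, v)` that is only lazily evaluated. -/
def child (P : SPProblem V) (τ : LRANode V) (p v : V) : LRANode V :=
  ⟨some p, τ.cost, τ.lcost + P.lazyCost p v, τ.budget + 1⟩

/-- In state `s`, the node `τ` of vertex `p` offers `v` a place in the tree, as a child of `p`,
and `v` either has no node yet or its present node has a larger key. Frontier nodes (whose budget
is `α`) and the node of the target have no children. -/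
def Offers (P : SPProblem V) (α : ℕ∞) (s : LRAState V) (p : V) (τ : LRANode V) (v : V) : Prop :=
  s.tree p = some τ ∧ p ≠ P.target ∧ (τ.budget : ℕ∞) < α ∧ (p, v) ∈ s.edges ∧
    ∀ σ, s.tree v = some σ → (child P τ p v).key < σ.key

/-- Among all offers to vertices in `S`, the offer of `p` (with node `τ`) to `v` has the smallest
key. -/
def BestOffer (P : SPProblem V) (α : ℕ∞) (s : LRAState V) (S : Set V)
    (o : V × LRANode V × V) : Prop :=
  o.2.2 ∈ S ∧ Offers P α s o.1 o.2.1 o.2.2 ∧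
    ∀ p τ v, v ∈ S → Offers P α s p τ v →
      (child P o.2.1 o.1 o.2.2).key ≤ (child P τ p v).key

open Classical in
/-- Insert the offered child node of `v`. If `v` already has a node, it is removed together with
its subtree before. -/
noncomputable def attach (P : SPProblem V) (s : LRAState V) (o : V × LRANode V × V) :
    LRAState V :=
  { s with
    tree := Function.update (removeNodes s.tree (subtree s.tree o.2.2)) o.2.2
      (some (child P o.2.1 o.1 o.2.2))
    pending := s.pending \ {o.2.2} }

/-! ### Evaluating edges -/

open Classical in
/-- Update the tree after the edge `(u, v)` from a border node to a child of it has been found to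
be collision-free: in the path to `v` and in the paths to all its descendants, the edge moves from
the lazily evaluated tail to the evaluated head. -/
noncomputable def updateFree (P : SPProblem V) (T : V → Option (LRANode V)) (u v : V) :
    V → Option (LRANode V) :=
  fun x =>
    if x ∈ subtree T v then
      (T x).map fun τ =>
        ⟨τ.parent, τ.cost + P.lazyCost u v, τ.lcost - P.lazyCost u v, τ.budget - 1⟩
    else T x

open Classical in
/-- Evaluate the listed edges in order. The evaluation stops as soon as an edge is found to be in
collision (it is then removed from the graph, and the subtree below it has to be rewired) or an
edge that leads to the target is found to be collision-free (the algorithm then returns). -/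
noncomputable def evaluateEdges (P : SPProblem V) : LRAState V → List (V × V) → LRAState V
  | s, [] => s
  | s, (u, v) :: es =>
    if P.trueCost u v = ⊤ then
      { s with
        tree := removeNodes s.tree (subtree s.tree v)
        edges := s.edges \ {(u, v)}
        evaluated := insert (u, v) s.evaluated
        pending := subtree s.tree v }
    else if v = P.target then
      { s with
        tree := updateFree P s.tree u v
        evaluated := insert (u, v) s.evaluated
        finished := True }
    else
      evaluateEdges P
        { s with
          tree := updateFree P s.tree u v
          evaluated := insert (u, v) s.evaluated } es

/-- `v` has a node in the frontier queue: its budget is `α`, or `v` is the target. -/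
def InFrontier (P : SPProblem V) (α : ℕ∞) (s : LRAState V) (v : V) (τ : LRANode V) : Prop :=
  s.tree v = some τ ∧ ((τ.budget : ℕ∞) = α ∨ v = P.target)

/-- `v` has a node in the frontier queue, of minimal key. -/
def IsMinFrontier (P : SPProblem V) (α : ℕ∞) (s : LRAState V) (v : V) : Prop :=
  ∃ τ, InFrontier P α s v τ ∧ ∀ v' τ', InFrontier P α s v' τ' → τ.key ≤ τ'.key

/-- The first `β` elements of a list (all of them if it is shorter). -/
noncomputable def takeFirst {A : Type*} (β : ℕ∞) (l : List A) : List A :=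
  l.take (min β (l.length : ℕ∞)).toNat

open Classical in
/-- One elementary step of LRA* with lookahead `α` and greediness `β`.
* If nodes are waiting to be rewired, the one with the best offer is rewired to its best parent;
  those that receive no offer stay out of the tree.
* Otherwise the `α`-band is extended, in the order of the keys, as long as this is possible.
* Otherwise a node of minimal key is chosen from the frontier queue, and the first `β` edges of the
  lazily evaluated tail of its path are evaluated. If the queue is empty, the algorithm has failed
  and nothing happens any more. -/
noncomputable def step (P : SPProblem V) (α β : ℕ∞) (s : LRAState V) : LRAState V :=
  if s.finished then s
  else if h : ∃ o, BestOffer P α s s.pending o then attach P s h.choose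
  else if s.pending.Nonempty then { s with pending := ∅ }
  else if h : ∃ o, BestOffer P α s Set.univ o then attach P s h.choose
  else if h : ∃ v, IsMinFrontier P α s v then
    evaluateEdges P s (takeFirst β (tail s.tree h.choose))
  else s

end LRAState

/-- The set of edges that LRA* with lookahead `α` and greediness `β` evaluates in its run on the
shortest-path problem `P`. -/
def LRAEvaluatedEdges {V : Type*} (P : SPProblem V) (α β : ℕ∞) : Set (V × V) :=
  {e | ∃ k : ℕ, e ∈ ((LRAState.step P α β)^[k] (LRAState.init P)).evaluated}

/-! Compare a state `s` of the run with greediness 1 with a terminal state `f` of the run with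
greediness `β`, and show by induction on the steps that everything evaluated in `s` is evaluated in
`f`. Suppose `s` selects the frontier vertex `w` and the first edge of its tail is not evaluated in
`f`. The graph of `f` is contained in that of `s`, and the path to `w` is cheapest in `s`. Its head
is also a head in `f` (`Inv.exists_budget_eq_zero`). No edge of its tail is evaluated in `f`:
evaluating an edge requires an evaluated path to its first vertex, and by the absence of ties that
path would have to run through the unevaluated edge before it (`Inv.unevaluated_step`). So the whole
path survives in the graph of `f` and is the unique cheapest one there.

Let `g` be a fully extended state with the graph of `f`: the state of the last selection if a path
was returned, and `f` itself after a failure. The tree of `g` contains this path with at least as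
large a budget, or has a frontier node at most as expensive (`IsBandPath.covered`). Either way `g`
has a frontier node of key at most that of `w`, which rules out failure. After a success, the
returned path costs at most the key of `w`; by minimality of `w` in `s` it costs at least that much.
Without ties `w` is the target, but the target is evaluated in `f` and `w` is not.

Two facts support this: nodes of budget 0 always lie on cheapest paths of the current graph
(`Inv.lower`), and the run reaches a terminal state (`exists_terminal`). -/

namespace SPProblem

/-! ### Walks, lower bounds on distances, and uniqueness of cheapest paths. -/

variable {V : Type*} {P : SPProblem V}

/-- There is a walk of lazy cost `c` from the source to `v` along edges in `E`. -/
inductive Reach (P : SPProblem V) (E : Set (V × V)) : V → ℝ → Prop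
  | source : Reach P E P.source 0
  | step {u v : V} {c : ℝ} : Reach P E u c → (u, v) ∈ E → Reach P E v (c + P.lazyCost u v)

theorem Reach.mono {E F : Set (V × V)} (h : E ⊆ F) {v : V} {c : ℝ} (hr : P.Reach E v c) :
    P.Reach F v c := by
  induction hr with
  | source => exact .source
  | step _ he ih => exact .step ih (h he)

/-- No walk to `v` along edges in `E` is cheaper than `c`. -/
def IsLower (P : SPProblem V) (E : Set (V × V)) (v : V) (c : ℝ) : Prop :=
  ∀ c', P.Reach E v c' → c ≤ c'

theorem IsLower.anti {E F : Set (V × V)} (h : E ⊆ F) {v : V} {c : ℝ} (hl : P.IsLower F v c) :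
    P.IsLower E v c :=
  fun _ hr => hl _ (hr.mono h)

theorem IsLower.pred {E : Set (V × V)} {u v : V} {c : ℝ} (he : (u, v) ∈ E)
    (hl : P.IsLower E v (c + P.lazyCost u v)) : P.IsLower E u c :=
  fun _ hr => le_of_add_le_add_right (hl _ (hr.step he))

theorem lazyPathCost_concat (P : SPProblem V) (l : List V) (u v : V) :
    P.lazyPathCost (l ++ [u] ++ [v]) = P.lazyPathCost (l ++ [u]) + P.lazyCost u v := by
  induction l with
  | nil => simp [lazyPathCost]
  | cons a l ih =>
    cases l with
    | nil => simp [lazyPathCost]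
    | cons b l =>
      simp only [lazyPathCost, List.cons_append, List.tail_cons, List.zipWith_cons_cons,
        List.sum_cons] at ih ⊢
      linarith

/-- `l ++ [v]` is a simple path of cost `c` through vertices that are not farther away than `c`. -/
def IsShortList (P : SPProblem V) (E : Set (V × V)) (l : List V) (v : V) (c : ℝ) : Prop :=
  P.IsSimplePathFromSource (l ++ [v]) ∧ P.lazyPathCost (l ++ [v]) = c ∧
    ∀ y ∈ l ++ [v], ∃ c' ≤ c, P.Reach E y c'

/-- Simplicity is preserved because every vertex already listed is reachable at cost at most `c`,
whereas `v` is not reachable below `c + P.lazyCost u v`, which is strictly larger. -/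
theorem IsShortList.concat {E : Set (V × V)} (hE : ∀ e ∈ E, P.graph.Adj e.1 e.2) {l : List V}
    {u v : V} {c : ℝ} (h : P.IsShortList E l u c) (hu : P.Reach E u c) (he : (u, v) ∈ E)
    (hl : P.IsLower E v (c + P.lazyCost u v)) :
    P.IsShortList E (l ++ [u]) v (c + P.lazyCost u v) := by
  obtain ⟨⟨h1, h2, h3⟩, h4, h5⟩ := h
  have hw := P.lazyCost_pos u v (hE _ he)
  refine ⟨⟨?_, ?_, ?_⟩, ?_, ?_⟩
  · rw [List.head?_append, h1]; rfl
  · rw [List.isChain_append]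
    refine ⟨h2, List.isChain_singleton _, ?_⟩
    intro x hx y hy
    simp only [List.getLast?_append, List.getLast?_singleton, Option.some_or, Option.mem_def,
      Option.some.injEq, List.head?_cons] at hx hy
    subst hx hy
    exact hE _ he
  · rw [← List.concat_eq_append, List.nodup_concat]
    refine ⟨?_, h3⟩
    intro hv
    obtain ⟨c', hc', hr⟩ := h5 v hv
    have := hl _ hr
    linarith
  · rw [lazyPathCost_concat, h4]
  · intro y hy
    rcases List.mem_append.1 hy with hy | hy
    · obtain ⟨c', hc', hr⟩ := h5 y hy
      exact ⟨c', by linarith, hr⟩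
    · rw [List.mem_singleton] at hy
      subst hy
      exact ⟨_, le_rfl, hu.step he⟩

/-- The bridge from walks to `NoTies`, which only speaks of simple paths: a cheapest walk is simple
since costs are positive. -/
theorem exists_isShortList {E : Set (V × V)} (hE : ∀ e ∈ E, P.graph.Adj e.1 e.2) {v : V} {c : ℝ}
    (hr : P.Reach E v c) (hl : P.IsLower E v c) : ∃ l, P.IsShortList E l v c := by
  induction hr with
  | source =>
    refine ⟨[], ⟨by simp, by simp, by simp⟩, by simp [lazyPathCost], ?_⟩
    intro y hy
    rw [List.nil_append, List.mem_singleton] at hy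
    subst hy
    exact ⟨0, le_rfl, .source⟩
  | step hu he ih =>
    obtain ⟨l, h⟩ := ih (hl.pred he)
    exact ⟨_, h.concat hE hu he hl⟩

theorem NoTies.eq_of_dist_eq (hP : P.NoTies) {E : Set (V × V)}
    (hE : ∀ e ∈ E, P.graph.Adj e.1 e.2) {u v : V} {c : ℝ} (hu : P.Reach E u c)
    (hv : P.Reach E v c) (hul : P.IsLower E u c) (hvl : P.IsLower E v c) : u = v := by
  obtain ⟨l, hl⟩ := exists_isShortList hE hu hul
  obtain ⟨m, hm⟩ := exists_isShortList hE hv hvl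
  have := hP _ _ hl.1 hm.1 (hl.2.1.trans hm.2.1.symm)
  simpa using (List.append_inj' this rfl).2

/-- Two cheapest paths to `v` are the same vertex list, so their last but one vertices agree. -/
theorem NoTies.pred_unique (hP : P.NoTies) {E : Set (V × V)}
    (hE : ∀ e ∈ E, P.graph.Adj e.1 e.2) {p q v : V} {a b : ℝ} (hp : P.Reach E p a)
    (hq : P.Reach E q b) (hpv : (p, v) ∈ E) (hqv : (q, v) ∈ E)
    (hl : P.IsLower E v (a + P.lazyCost p v))
    (hab : a + P.lazyCost p v = b + P.lazyCost q v) : p = q := by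
  have hl' : P.IsLower E v (b + P.lazyCost q v) := hab ▸ hl
  obtain ⟨l, h⟩ := exists_isShortList hE hp (hl.pred hpv)
  obtain ⟨m, h'⟩ := exists_isShortList hE hq (hl'.pred hqv)
  have h := h.concat hE hp hpv hl
  have h' := h'.concat hE hq hqv hl'
  have := hP _ _ h.1 h'.1 (h.2.1.trans (hab.trans h'.2.1.symm))
  simpa using (List.append_inj' (List.append_inj' this rfl).1 rfl).2

theorem trueCost_eq_top_iff (P : SPProblem V) (u v : V) :
    P.trueCost u v = ⊤ ↔ P.inCollision u v := by
  unfold trueCost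
  split_ifs with h <;> simp [h]

end SPProblem

/-! ### The invariant and its preservation by single operations. -/

namespace LRAState

variable {V : Type*} {P : SPProblem V} {α : ℕ∞} {s : LRAState V}

/-- The invariant of the states of LRA*. -/
structure Inv (P : SPProblem V) (α : ℕ∞) (s : LRAState V) : Prop where
  root : s.tree P.source = some ⟨none, 0, 0, 0⟩
  parent : ∀ v τ, s.tree v = some τ → v ≠ P.source → ∃ p σ, τ.parent = some p ∧
    s.tree p = some σ ∧ (p, v) ∈ s.edges ∧ p ≠ P.target ∧ τ.key = σ.key + P.lazyCost p v ∧
    ((τ.budget = 0 ∧ σ.budget = 0 ∧ (p, v) ∈ s.evaluated) ∨ τ.budget = σ.budget + 1)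
  budget_le : ∀ v τ, s.tree v = some τ → (τ.budget : ℕ∞) ≤ α
  mem_edges : ∀ u v, (u, v) ∈ s.edges ↔
    P.graph.Adj u v ∧ ¬ ((u, v) ∈ s.evaluated ∧ P.inCollision u v)
  lower : ∀ v τ, s.tree v = some τ → τ.budget = 0 → P.IsLower s.edges v τ.key
  head : ∀ u v, (u, v) ∈ s.evaluated → ∃ σ, s.tree u = some σ ∧ σ.budget = 0
  child_head : ∀ u v, (u, v) ∈ s.evaluated → ¬ P.inCollision u v →
    ∃ τ, s.tree v = some τ ∧ τ.parent = some u ∧ τ.budget = 0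
  not_finished : ∀ τ, s.tree P.target = some τ → τ.budget = 0 → ¬ s.finished →
    P.target = P.source

namespace Inv

theorem adj (h : Inv P α s) : ∀ e ∈ s.edges, P.graph.Adj e.1 e.2 :=
  fun e he => ((h.mem_edges e.1 e.2).1 he).1

theorem lazyCost_pos (h : Inv P α s) {u v : V} (he : (u, v) ∈ s.edges) : 0 < P.lazyCost u v :=
  P.lazyCost_pos u v (h.adj _ he)

theorem ne_source_of_parent (h : Inv P α s) {p v : V} {τ : LRANode V} (hv : s.tree v = some τ)
    (hp : τ.parent = some p) : v ≠ P.source := by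
  rintro rfl
  rw [h.root] at hv
  cases hv
  cases hp

theorem of_parent (h : Inv P α s) {p v : V} {τ : LRANode V} (hv : s.tree v = some τ)
    (hp : τ.parent = some p) : ∃ σ, s.tree p = some σ ∧ (p, v) ∈ s.edges ∧ p ≠ P.target ∧
    τ.key = σ.key + P.lazyCost p v ∧
    ((τ.budget = 0 ∧ σ.budget = 0 ∧ (p, v) ∈ s.evaluated) ∨ τ.budget = σ.budget + 1) := by
  obtain ⟨q, σ, hq, h'⟩ := h.parent v τ hv (h.ne_source_of_parent hv hp)
  rw [hp] at hq
  cases hq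
  exact ⟨σ, h'⟩

/-- Induction along the branches of the search tree. -/
theorem tree_induction [Finite V] (h : Inv P α s) {motive : V → LRANode V → Prop}
    (root : motive P.source ⟨none, 0, 0, 0⟩)
    (step : ∀ p σ v τ, s.tree p = some σ → s.tree v = some τ → τ.parent = some p →
      motive p σ → motive v τ) (v : V) (τ : LRANode V) (hv : s.tree v = some τ) : motive v τ := by
  -- Keys strictly increase from parent to child and `V` is finite, so induction on the key is well
  -- founded. The default 0 is never looked at.
  let k : V → ℝ := fun x => (s.tree x).elim 0 LRANode.key
  have hk : ∀ x ρ, s.tree x = some ρ → k x = ρ.key := fun x ρ hx => by simp [k, hx]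
  have wf : WellFounded (fun a b : V => k a < k b) := by
    have : IsTrans V (fun a b => k a < k b) := ⟨fun _ _ _ => lt_trans⟩
    have : Std.Irrefl (fun a b : V => k a < k b) := ⟨fun _ => lt_irrefl _⟩
    exact Finite.wellFounded_of_trans_of_irrefl _
  induction v using wf.induction generalizing τ with
  | _ v ih =>
    by_cases hs : v = P.source
    · subst hs
      rw [h.root] at hv
      cases hv
      exact root
    · obtain ⟨p, σ, hp, hσ, he, -, hkey, -⟩ := h.parent v τ hv hs
      refine step p σ v τ hσ hv hp (ih p ?_ σ hσ)
      have := h.lazyCost_pos he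
      change k p < k v
      rw [hk _ _ hσ, hk _ _ hv]
      linarith

theorem reach [Finite V] (h : Inv P α s) {v : V} {τ : LRANode V} (hv : s.tree v = some τ) :
    P.Reach s.edges v τ.key := by
  refine h.tree_induction (motive := fun v τ => P.Reach s.edges v τ.key) ?_ ?_ v τ hv
  · simpa [LRANode.key] using SPProblem.Reach.source
  · intro p σ v τ _ hv hp hr
    obtain ⟨σ', hσ', he, -, hkey, -⟩ := h.of_parent hv hp
    simp_all only [Option.some.injEq]
    exact hr.step he

/-- The nodes of a subtree have at least the key of its root, and a positive budget if the root
has one. -/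
theorem of_mem_subtree (h : Inv P α s) {v x : V} (hx : x ∈ subtree s.tree v) {τ : LRANode V}
    (hτ : s.tree x = some τ) : ∃ σ, s.tree v = some σ ∧ σ.key ≤ τ.key ∧
      (τ.budget = 0 → σ.budget = 0) ∧ (x ≠ v → σ.budget ≠ 0 → 2 ≤ τ.budget) := by
  change Relation.ReflTransGen _ _ _ at hx
  induction hx generalizing τ with
  | refl => exact ⟨τ, hτ, le_rfl, id, fun h => absurd rfl h⟩
  | tail _ hb ih =>
    obtain ⟨τ', hτ', hp⟩ := hb
    rw [hτ] at hτ'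
    cases hτ'
    obtain ⟨σ, hσ, he, -, hkey, hbud⟩ := h.of_parent hτ hp
    obtain ⟨ρ, hρ, h1, h2, h3⟩ := ih hσ
    have := h.lazyCost_pos he
    refine ⟨ρ, hρ, by linarith, fun h0 => h2 (by omega), fun _ h0 => ?_⟩
    have : σ.budget ≠ 0 := fun hz => h0 (h2 hz)
    omega

theorem not_mem_subtree_of_budget_eq_zero (h : Inv P α s) {v x : V} {τ : LRANode V}
    (hτ : s.tree x = some τ) (h0 : τ.budget = 0)
    (hv : ∀ σ, s.tree v = some σ → σ.budget ≠ 0) : x ∉ subtree s.tree v := by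
  intro hx
  obtain ⟨σ, hσ, -, h1, -⟩ := h.of_mem_subtree hx hτ
  exact hv σ hσ (h1 h0)

theorem mem_subtree_of_parent {T : V → Option (LRANode V)} {v p x : V} {τ : LRANode V}
    (hτ : T x = some τ) (hp : τ.parent = some p) (h : p ∈ subtree T v) : x ∈ subtree T v :=
  Relation.ReflTransGen.tail h ⟨τ, hτ, hp⟩

theorem parent_mem_subtree {T : V → Option (LRANode V)} {v p x : V} {τ : LRANode V}
    (hτ : T x = some τ) (hp : τ.parent = some p) (h : x ∈ subtree T v) (hne : x ≠ v) :
    p ∈ subtree T v := by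
  rcases Relation.ReflTransGen.cases_tail h with h | ⟨q, hq, τ', hτ', hp'⟩
  · exact absurd h hne
  · rw [hτ] at hτ'
    cases hτ'
    rw [hp] at hp'
    cases hp'
    exact hq

theorem init (P : SPProblem V) (α : ℕ∞) : Inv P α (init P) := by
  have key : ∀ v τ, (LRAState.init P).tree v = some τ → v = P.source ∧ τ = ⟨none, 0, 0, 0⟩ := by
    intro v τ h
    simp only [LRAState.init] at h
    split_ifs at h with hv
    exact ⟨hv, (Option.some.inj h).symm⟩
  have pos : ∀ v c, P.Reach (LRAState.init P).edges v c → 0 ≤ c := by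
    intro v c hr
    induction hr with
    | source => exact le_rfl
    | step _ he ih => exact add_nonneg ih (P.lazyCost_pos _ _ he).le
  refine ⟨by simp [LRAState.init], ?_, ?_, ?_, ?_, ?_, ?_, ?_⟩
  · intro v τ h hv
    exact absurd (key v τ h).1 hv
  · intro v τ h
    rw [(key v τ h).2]
    simp
  · intro u v
    simp [LRAState.init]
  · intro v τ h _ c hr
    rw [(key v τ h).2]
    simpa [LRANode.key] using pos v c hr
  · intro u v h
    exact absurd h (Set.notMem_empty _)
  · intro u v h
    exact absurd h (Set.notMem_empty _)
  · intro τ h _ _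
    exact (key _ τ h).1

theorem with_pending (h : Inv P α s) (S : Set V) : Inv P α { s with pending := S } :=
  ⟨h.root, h.parent, h.budget_le, h.mem_edges, h.lower, h.head, h.child_head, h.not_finished⟩

end Inv

theorem removeNodes_eq_some {T : V → Option (LRANode V)} {S : Set V} {x : V} {τ : LRANode V} :
    removeNodes T S x = some τ ↔ x ∉ S ∧ T x = some τ := by
  unfold removeNodes
  split_ifs with h <;> simp [h]

theorem child_key (P : SPProblem V) (τ : LRANode V) (p v : V) :
    (child P τ p v).key = τ.key + P.lazyCost p v := by
  simp [child, LRANode.key, add_assoc]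

/-- An offered vertex is not the end of an evaluated path. -/
theorem Inv.budget_ne_zero_of_offers [Finite V] (h : Inv P α s) {p v : V} {τ : LRANode V}
    (ho : Offers P α s p τ v) {σ : LRANode V} (hσ : s.tree v = some σ) : σ.budget ≠ 0 := by
  intro h0
  obtain ⟨hp, -, -, he, hk⟩ := ho
  have h1 := hk σ hσ
  rw [child_key] at h1
  exact absurd (h.lower v σ hσ h0 _ ((h.reach hp).step he)) (not_le.2 h1)

/-- Attaching creates no cycle: a `p` below `v` would have at least the key of `v`, so its offer
could not undercut that key. -/
theorem Inv.not_mem_subtree_of_offers (h : Inv P α s) {p v : V} {τ : LRANode V}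
    (ho : Offers P α s p τ v) : p ∉ subtree s.tree v := by
  intro hm
  obtain ⟨hp, -, -, he, hk⟩ := ho
  obtain ⟨σ, hσ, h1, -⟩ := h.of_mem_subtree hm hp
  have h2 := hk σ hσ
  rw [child_key] at h2
  have := h.lazyCost_pos he
  linarith

theorem attach_tree_self (P : SPProblem V) (s : LRAState V) (p v : V) (τ : LRANode V) :
    (attach P s (p, τ, v)).tree v = some (child P τ p v) := by
  simp [attach]

theorem attach_tree_of_not_mem (P : SPProblem V) (s : LRAState V) (p v x : V) (τ : LRANode V)
    (hx : x ∉ subtree s.tree v) : (attach P s (p, τ, v)).tree x = s.tree x := by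
  classical
  have hne : x ≠ v := by
    rintro rfl
    exact hx Relation.ReflTransGen.refl
  exact (Function.update_of_ne hne _ _).trans (by simp [removeNodes, hx])

theorem attach_tree_cases {p v x : V} {τ ρ : LRANode V}
    (hx : (attach P s (p, τ, v)).tree x = some ρ) :
    (x = v ∧ ρ = child P τ p v) ∨ (x ∉ subtree s.tree v ∧ s.tree x = some ρ) := by
  classical
  by_cases hxv : x = v
  · subst hxv
    rw [attach_tree_self] at hx
    exact .inl ⟨rfl, (Option.some.inj hx).symm⟩
  · right
    exact removeNodes_eq_some.1 ((Function.update_of_ne hxv _ _).symm.trans hx)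

/-- Any offer will do, not only a best one, so the invariant is insensitive to the order of rewiring
and extending. The attached node has positive budget, hence the statements about evaluated paths
carry over. -/
theorem Inv.attach [Finite V] (h : Inv P α s) {p v : V} {τ : LRANode V}
    (ho : Offers P α s p τ v) : Inv P α (attach P s (p, τ, v)) := by
  have hp := h.not_mem_subtree_of_offers ho
  have h0 : ∀ x σ, s.tree x = some σ → σ.budget = 0 → x ∉ subtree s.tree v := fun x σ hx hb =>
    h.not_mem_subtree_of_budget_eq_zero hx hb fun _ => h.budget_ne_zero_of_offers ho
  have keep : ∀ x σ, s.tree x = some σ → σ.budget = 0 →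
      (LRAState.attach P s (p, τ, v)).tree x = some σ := fun x σ hx hb => by
    rw [attach_tree_of_not_mem _ _ _ _ _ _ (h0 x σ hx hb), hx]
  have old : ∀ x ρ, (LRAState.attach P s (p, τ, v)).tree x = some ρ → ρ.budget = 0 →
      s.tree x = some ρ := by
    intro x ρ hx hb
    rcases attach_tree_cases hx with ⟨rfl, rfl⟩ | ⟨-, hx⟩
    · simp [child] at hb
    · exact hx
  refine ⟨keep _ _ h.root rfl, ?_, ?_, h.mem_edges, ?_, ?_, ?_, ?_⟩
  · intro x ρ hx hs
    rcases attach_tree_cases hx with ⟨rfl, rfl⟩ | ⟨hm, hx⟩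
    · exact ⟨p, τ, rfl, by rw [attach_tree_of_not_mem _ _ _ _ _ _ hp, ho.1], ho.2.2.2.1, ho.2.1,
        child_key .., .inr rfl⟩
    · obtain ⟨q, σ, hq, hσ, h'⟩ := h.parent x ρ hx hs
      refine ⟨q, σ, hq, ?_, h'⟩
      rw [attach_tree_of_not_mem _ _ _ _ _ _ fun hqm => hm (Inv.mem_subtree_of_parent hx hq hqm),
        hσ]
  · intro x ρ hx
    rcases attach_tree_cases hx with ⟨rfl, rfl⟩ | ⟨-, hx⟩
    · simpa [child] using Order.add_one_le_of_lt ho.2.2.1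
    · exact h.budget_le x ρ hx
  · exact fun x ρ hx hb => h.lower x ρ (old x ρ hx hb) hb
  · intro x y hxy
    obtain ⟨σ, hσ, hb⟩ := h.head x y hxy
    exact ⟨σ, keep _ _ hσ hb, hb⟩
  · intro x y hxy hc
    obtain ⟨σ, hσ, hq, hb⟩ := h.child_head x y hxy hc
    exact ⟨σ, keep _ _ hσ hb, hq, hb⟩
  · exact fun ρ hx hb hf => h.not_finished ρ (old _ ρ hx hb) hb hf

/-- Evaluating the first edge of a tail, when it is in collision. -/
theorem Inv.evaluate_collision (h : Inv P α s) {u v : V} {σ τ : LRANode V} (S : Set V)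
    (hu : s.tree u = some σ) (hu0 : σ.budget = 0) (hv : s.tree v = some τ)
    (hv0 : τ.budget ≠ 0) (hc : P.inCollision u v) :
    Inv P α { s with
      tree := removeNodes s.tree (subtree s.tree v)
      edges := s.edges \ {(u, v)}
      evaluated := insert (u, v) s.evaluated
      pending := S } := by
  have hv0' : ∀ σ, s.tree v = some σ → σ.budget ≠ 0 := by
    intro σ hσ
    rw [hv] at hσ
    cases hσ
    exact hv0
  have keep : ∀ x σ, s.tree x = some σ → σ.budget = 0 →
      removeNodes s.tree (subtree s.tree v) x = some σ := fun x σ hx hb =>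
    removeNodes_eq_some.2 ⟨h.not_mem_subtree_of_budget_eq_zero hx hb hv0', hx⟩
  refine ⟨keep _ _ h.root rfl, ?_, ?_, ?_, ?_, ?_, ?_, ?_⟩
  · intro x ρ hx hs
    obtain ⟨hm, hx⟩ := removeNodes_eq_some.1 hx
    obtain ⟨q, ρ', hq, hρ', he, hne, hkey, hb⟩ := h.parent x ρ hx hs
    refine ⟨q, ρ', hq, removeNodes_eq_some.2
      ⟨fun hqm => hm (Inv.mem_subtree_of_parent hx hq hqm), hρ'⟩, ⟨he, ?_⟩, hne, hkey, ?_⟩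
    · rintro heq
      cases heq
      exact hm Relation.ReflTransGen.refl
    · exact hb.imp (fun h => ⟨h.1, h.2.1, Set.mem_insert_of_mem _ h.2.2⟩) id
  · exact fun x ρ hx => h.budget_le x ρ (removeNodes_eq_some.1 hx).2
  · intro x y
    simp only [Set.mem_sdiff, Set.mem_singleton_iff, Set.mem_insert_iff, h.mem_edges x y]
    constructor
    · rintro ⟨⟨h1, h2⟩, h3⟩
      exact ⟨h1, fun h4 => h2 ⟨h4.1.resolve_left h3, h4.2⟩⟩
    · rintro ⟨h1, h2⟩
      refine ⟨⟨h1, fun h3 => h2 ⟨.inr h3.1, h3.2⟩⟩, fun h3 => h2 ⟨.inl h3, ?_⟩⟩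
      cases h3
      exact hc
  · exact fun x ρ hx hb => (h.lower x ρ (removeNodes_eq_some.1 hx).2 hb).anti Set.sdiff_subset
  · rintro x y (hxy | hxy)
    · cases hxy
      exact ⟨σ, keep _ _ hu hu0, hu0⟩
    · obtain ⟨ρ, hρ, hb⟩ := h.head x y hxy
      exact ⟨ρ, keep _ _ hρ hb, hb⟩
  · rintro x y (hxy | hxy) hc'
    · cases hxy
      exact absurd hc hc'
    · obtain ⟨ρ, hρ, hq, hb⟩ := h.child_head x y hxy hc'
      exact ⟨ρ, keep _ _ hρ hb, hq, hb⟩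
  · exact fun ρ hx hb hf => h.not_finished ρ (removeNodes_eq_some.1 hx).2 hb hf

/-- The update of a node in the subtree below an edge that is found to be collision-free. -/
def freed (P : SPProblem V) (u v : V) (τ : LRANode V) : LRANode V :=
  ⟨τ.parent, τ.cost + P.lazyCost u v, τ.lcost - P.lazyCost u v, τ.budget - 1⟩

theorem freed_key (P : SPProblem V) (u v : V) (τ : LRANode V) : (freed P u v τ).key = τ.key := by
  simp [freed, LRANode.key]

theorem updateFree_of_mem {T : V → Option (LRANode V)} {u v x : V} {τ : LRANode V}
    (hx : x ∈ subtree T v) (hτ : T x = some τ) : updateFree P T u v x = some (freed P u v τ) := by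
  simp [updateFree, hx, hτ, freed]

theorem updateFree_of_not_mem {T : V → Option (LRANode V)} {u v x : V}
    (hx : x ∉ subtree T v) : updateFree P T u v x = T x := by
  simp [updateFree, hx]

theorem updateFree_cases {T : V → Option (LRANode V)} {u v x : V} {ρ : LRANode V}
    (hx : updateFree P T u v x = some ρ) :
    (x ∈ subtree T v ∧ ∃ τ, T x = some τ ∧ ρ = freed P u v τ) ∨
      (x ∉ subtree T v ∧ T x = some ρ) := by
  by_cases hm : x ∈ subtree T v
  · left
    simp only [updateFree, hm, if_true, Option.map_eq_some_iff] at hx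
    obtain ⟨τ, hτ, rfl⟩ := hx
    exact ⟨hm, τ, hτ, rfl⟩
  · rw [updateFree_of_not_mem hm] at hx
    exact .inr ⟨hm, hx⟩

/-- Evaluating the first edge of a tail, when it is collision-free. -/
theorem Inv.evaluate_free (h : Inv P α s) {u v : V} {σ τ : LRANode V} {f : Prop}
    (hu : s.tree u = some σ) (hu0 : σ.budget = 0) (hv : s.tree v = some τ)
    (hv1 : τ.budget = 1) (hp : τ.parent = some u) (hc : ¬ P.inCollision u v)
    (hlow : P.IsLower s.edges v τ.key) (hf : s.finished → f) (hf' : v = P.target → f) :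
    Inv P α { s with
      tree := updateFree P s.tree u v
      evaluated := insert (u, v) s.evaluated
      finished := f } := by
  have hv0 : ∀ σ, s.tree v = some σ → σ.budget ≠ 0 := by
    intro σ hσ
    rw [hv] at hσ
    cases hσ
    omega
  have hself : v ∈ subtree s.tree v := Relation.ReflTransGen.refl
  have hnm : ∀ x σ, s.tree x = some σ → σ.budget = 0 → x ∉ subtree s.tree v := fun x σ hx hb =>
    h.not_mem_subtree_of_budget_eq_zero hx hb hv0
  have keep : ∀ x σ, s.tree x = some σ → σ.budget = 0 →
      updateFree P s.tree u v x = some σ := fun x σ hx hb => by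
    rw [updateFree_of_not_mem (hnm x σ hx hb), hx]
  have old : ∀ x ρ, updateFree P s.tree u v x = some ρ → ρ.budget = 0 →
      (x = v ∧ ρ = freed P u v τ) ∨ s.tree x = some ρ := by
    intro x ρ hx hb
    rcases updateFree_cases hx with ⟨hm, ρ', hρ', rfl⟩ | ⟨hm, hx⟩
    · left
      by_cases hxv : x = v
      · subst hxv
        rw [hv] at hρ'
        cases hρ'
        exact ⟨rfl, rfl⟩
      -- A proper descendant of `v` has budget at least 2 and cannot drop to 0.
      · obtain ⟨σ', hσ', -, -, h2⟩ := h.of_mem_subtree hm hρ'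
        have := h2 hxv (hv0 _ hσ')
        simp only [freed] at hb
        omega
    · exact .inr hx
  refine ⟨keep _ _ h.root rfl, ?_, ?_, ?_, ?_, ?_, ?_, ?_⟩
  · intro x ρ hx hs
    rcases updateFree_cases hx with ⟨hm, ρ', hρ', rfl⟩ | ⟨hm, hx⟩
    · obtain ⟨q, σ', hq, hσ', he, hne, hkey, hb⟩ := h.parent x ρ' hρ' hs
      by_cases hxv : x = v
      · subst hxv
        rw [hv] at hρ'
        cases hρ'
        rw [hp] at hq
        cases hq
        rw [hu] at hσ'
        cases hσ'
        refine ⟨u, σ, hp, keep u σ hu hu0, he, hne, by rw [freed_key, hkey], .inl ⟨?_, hu0, ?_⟩⟩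
        · simp [freed, hv1]
        · exact Set.mem_insert _ _
      · have hqm := Inv.parent_mem_subtree hρ' hq hm hxv
        refine ⟨q, _, hq, updateFree_of_mem hqm hσ', he, hne,
          by rw [freed_key, freed_key, hkey], .inr ?_⟩
        -- Needed because the subtraction of budgets is truncated at 0.
        have : σ'.budget ≠ 0 := fun h0 => hnm q σ' hσ' h0 hqm
        simp only [freed]
        omega
    · obtain ⟨q, σ', hq, hσ', he, hne, hkey, hb⟩ := h.parent x ρ hx hs
      refine ⟨q, σ', hq, ?_, he, hne, hkey, ?_⟩
      · change updateFree P s.tree u v q = _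
        rw [updateFree_of_not_mem fun hqm => hm (Inv.mem_subtree_of_parent hx hq hqm), hσ']
      · exact hb.imp (fun h => ⟨h.1, h.2.1, Set.mem_insert_of_mem _ h.2.2⟩) id
  · intro x ρ hx
    rcases updateFree_cases hx with ⟨-, ρ', hρ', rfl⟩ | ⟨-, hx⟩
    · refine le_trans ?_ (h.budget_le x ρ' hρ')
      exact_mod_cast Nat.sub_le _ _
    · exact h.budget_le x ρ hx
  · intro x y
    simp only [Set.mem_insert_iff, h.mem_edges x y]
    refine and_congr_right fun _ => not_congr ⟨fun h => ⟨.inr h.1, h.2⟩, ?_⟩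
    rintro ⟨h1 | h1, h2⟩
    · cases h1
      exact absurd h2 hc
    · exact ⟨h1, h2⟩
  · intro x ρ hx hb
    rcases old x ρ hx hb with ⟨rfl, rfl⟩ | hx
    · rw [freed_key]
      exact hlow
    · exact h.lower x ρ hx hb
  · rintro x y (hxy | hxy)
    · cases hxy
      exact ⟨σ, keep _ _ hu hu0, hu0⟩
    · obtain ⟨ρ, hρ, hb⟩ := h.head x y hxy
      exact ⟨ρ, keep _ _ hρ hb, hb⟩
  · rintro x y (hxy | hxy) hc'
    · cases hxy
      exact ⟨_, updateFree_of_mem hself hv, hp, by simp [freed, hv1]⟩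
    · obtain ⟨ρ, hρ, hq, hb⟩ := h.child_head x y hxy hc'
      exact ⟨ρ, keep _ _ hρ hb, hq, hb⟩
  · intro ρ hx hb hnf
    rcases old _ ρ hx hb with ⟨ht, -⟩ | hx
    · exact absurd (hf' ht.symm) hnf
    · exact h.not_finished ρ hx hb fun hsf => hnf (hf hsf)

end LRAState

/-! ### Tails as paths in the tree, and evaluation of several edges. -/

namespace LRAState

variable {V : Type*} {P : SPProblem V} {α : ℕ∞} {s : LRAState V}

/-- `es` is a path of tree edges from `x` to `z`, along which the budgets count up from `b`. -/
def IsBandPath (T : V → Option (LRANode V)) : ℕ → V → List (V × V) → V → Prop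
  | _, x, [], z => x = z
  | b, x, (u, y) :: es, z => u = x ∧
    (∃ τ, T y = some τ ∧ τ.parent = some x ∧ τ.budget = b + 1) ∧ IsBandPath T (b + 1) y es z

theorem IsBandPath.concat {T : V → Option (LRANode V)} {b : ℕ} {x y z : V} {es : List (V × V)}
    (h : IsBandPath T b x es y) {τ : LRANode V} (hz : T z = some τ) (hp : τ.parent = some y)
    (hb : τ.budget = b + es.length + 1) : IsBandPath T b x (es ++ [(y, z)]) z := by
  induction es generalizing b x with
  | nil =>
    cases h
    exact ⟨rfl, ⟨τ, hz, hp, hb⟩, rfl⟩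
  | cons e es ih =>
    obtain ⟨h1, h2, h3⟩ := h
    refine ⟨h1, h2, ih h3 ?_⟩
    rw [hb, List.length_cons]
    ring

theorem IsBandPath.take {T : V → Option (LRANode V)} {b : ℕ} {x z : V} {es : List (V × V)}
    (h : IsBandPath T b x es z) (n : ℕ) : ∃ y, IsBandPath T b x (es.take n) y := by
  induction es generalizing b x n with
  | nil => exact ⟨z, by simpa using h⟩
  | cons e es ih =>
    cases n with
    | zero => exact ⟨x, rfl⟩
    | succ n =>
      obtain ⟨h1, h2, h3⟩ := h
      obtain ⟨y, hy⟩ := ih h3 n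
      exact ⟨y, h1, h2, hy⟩

/-- The rest of the path lies below `v`, so all its budgets drop by one together. After a free edge
the remaining list is again a tail that starts at budget 0. -/
theorem IsBandPath.updateFree {T : V → Option (LRANode V)} {u v : V} {b : ℕ} {x z : V}
    {es : List (V × V)} (h : IsBandPath T (b + 1) x es z) (hx : x ∈ subtree T v) :
    IsBandPath (updateFree P T u v) b x es z := by
  induction es generalizing b x with
  | nil => exact h
  | cons e es ih =>
    obtain ⟨h1, ⟨τ, hτ, hp, hb⟩, h3⟩ := h
    have hm := Inv.mem_subtree_of_parent hτ hp hx
    exact ⟨h1, ⟨_, updateFree_of_mem hm hτ, hp, by simp [freed, hb]⟩, ih h3 hm⟩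

theorem Inv.isBandPath_lastEdges (h : Inv P α s) (k : ℕ) {v : V} {τ : LRANode V}
    (hv : s.tree v = some τ) (hk : k ≤ τ.budget) : (lastEdges s.tree k v).length = k ∧
      ∃ x σ, s.tree x = some σ ∧ σ.budget = τ.budget - k ∧
        IsBandPath s.tree (τ.budget - k) x (lastEdges s.tree k v) v := by
  induction k generalizing v τ with
  | zero => exact ⟨rfl, v, τ, hv, rfl, rfl⟩
  | succ k ih =>
    have hs : v ≠ P.source := by
      rintro rfl
      rw [h.root] at hv
      cases hv
      simp at hk
    obtain ⟨p, σ, hp, hσ, -, -, -, hb⟩ := h.parent v τ hv hs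
    have hb : τ.budget = σ.budget + 1 := by omega
    obtain ⟨hlen, x, ρ, hρ, hρb, hpath⟩ := ih hσ (by omega)
    have heq : lastEdges s.tree (k + 1) v = lastEdges s.tree k p ++ [(p, v)] := by
      simp [lastEdges, hv, hp]
    have hsub : τ.budget - (k + 1) = σ.budget - k := by omega
    rw [heq, hsub]
    exact ⟨by simp [hlen], x, ρ, hρ, hρb, hpath.concat hv hp (by omega)⟩

/-- Initial portions of cheapest paths are cheapest. -/
theorem Inv.of_mem_lastEdges (h : Inv P α s) (k : ℕ) {v : V} {τ : LRANode V}
    (hv : s.tree v = some τ) (hl : P.IsLower s.edges v τ.key) :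
    ∀ e ∈ lastEdges s.tree k v, ∃ σ, s.tree e.2 = some σ ∧ σ.key ≤ τ.key ∧
      P.IsLower s.edges e.2 σ.key := by
  induction k generalizing v τ with
  | zero => simp [lastEdges]
  | succ k ih =>
    intro e he
    cases hp : τ.parent with
    | none => simp [lastEdges, hv, hp] at he
    | some p =>
      obtain ⟨σ, hσ, hpv, -, hkey, -⟩ := h.of_parent hv hp
      have := h.lazyCost_pos hpv
      simp only [lastEdges, hv, Option.bind_some, hp, List.mem_append, List.mem_singleton] at he
      rcases he with he | rfl
      · rw [hkey] at hl
        obtain ⟨ρ, h1, h2, h3⟩ := ih hσ (hl.pred hpv) e he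
        exact ⟨ρ, h1, by linarith, h3⟩
      · exact ⟨τ, hv, le_rfl, hl⟩

/-- The tail of a cheapest path, as a list that can be evaluated. -/
theorem Inv.isBandPath_tail (h : Inv P α s) {v : V} {τ : LRANode V} (hv : s.tree v = some τ) :
    (tail s.tree v).length = τ.budget ∧ ∃ x σ, s.tree x = some σ ∧ σ.budget = 0 ∧
      IsBandPath s.tree 0 x (tail s.tree v) v := by
  have := h.isBandPath_lastEdges τ.budget hv le_rfl
  simpa [tail, hv] using this

theorem Inv.of_mem_tail (h : Inv P α s) {v : V} {τ : LRANode V} (hv : s.tree v = some τ)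
    (hl : P.IsLower s.edges v τ.key) : ∀ e ∈ tail s.tree v, ∃ σ, s.tree e.2 = some σ ∧
      σ.key ≤ τ.key ∧ P.IsLower s.edges e.2 σ.key := by
  simpa [tail, hv] using h.of_mem_lastEdges τ.budget hv hl

theorem subset_evaluateEdges (P : SPProblem V) (s : LRAState V) (es : List (V × V)) :
    s.evaluated ⊆ (evaluateEdges P s es).evaluated := by
  induction es generalizing s with
  | nil => exact subset_rfl
  | cons e es ih =>
    obtain ⟨u, v⟩ := e
    simp only [evaluateEdges]
    split_ifs
    · exact Set.subset_insert _ _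
    · exact Set.subset_insert _ _
    · exact fun e he => ih _ (Set.mem_insert_of_mem _ he)

theorem mem_evaluateEdges (P : SPProblem V) (s : LRAState V) (e : V × V) (es : List (V × V)) :
    e ∈ (evaluateEdges P s (e :: es)).evaluated := by
  obtain ⟨u, v⟩ := e
  simp only [evaluateEdges]
  split_ifs
  · exact Set.mem_insert _ _
  · exact Set.mem_insert _ _
  · exact subset_evaluateEdges P _ _ (Set.mem_insert _ _)

theorem evaluateEdges_singleton_subset (P : SPProblem V) (s : LRAState V) (e : V × V) :
    (evaluateEdges P s [e]).evaluated ⊆ insert e s.evaluated := by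
  obtain ⟨u, v⟩ := e
  simp only [evaluateEdges]
  split_ifs <;> exact subset_rfl

/-- The bounds `hl` make each newly evaluated node satisfy `Inv.lower`; they persist because a free
edge changes neither keys nor graph. A collision stops the evaluation without finishing, so a
finishing evaluation leaves the graph unchanged. -/
theorem Inv.evaluateEdges (h : Inv P α s) (hf : ¬ s.finished) {x z : V} {σ : LRANode V}
    {es : List (V × V)} (hx : s.tree x = some σ) (hx0 : σ.budget = 0)
    (hes : IsBandPath s.tree 0 x es z)
    (hl : ∀ e ∈ es, ∃ τ, s.tree e.2 = some τ ∧ P.IsLower s.edges e.2 τ.key) :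
    Inv P α (evaluateEdges P s es) ∧ ((evaluateEdges P s es).finished →
      (evaluateEdges P s es).edges = s.edges ∧ (∃ e ∈ es, e.2 = P.target) ∧
      ∃ τ, (evaluateEdges P s es).tree P.target = some τ ∧ τ.budget = 0) := by
  induction es generalizing s x σ with
  | nil => exact ⟨h, fun h' => absurd h' hf⟩
  | cons e es ih =>
    obtain ⟨u, v⟩ := e
    obtain ⟨rfl, ⟨τ, hτ, hp, hb⟩, hpath⟩ := hes
    obtain ⟨τ', hτ', hlow⟩ := hl (u, v) List.mem_cons_self
    simp only [hτ, Option.some.injEq] at hτ'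
    subst hτ'
    have hself : v ∈ subtree s.tree v := Relation.ReflTransGen.refl
    simp only [LRAState.evaluateEdges]
    split_ifs with hc ht <;> rw [P.trueCost_eq_top_iff] at hc
    · exact ⟨h.evaluate_collision _ hx hx0 hτ (by omega) hc, fun h' => absurd h' hf⟩
    · refine ⟨h.evaluate_free hx hx0 hτ hb hp hc hlow (fun _ => trivial) fun _ => trivial,
        fun _ => ⟨rfl, ⟨(u, v), List.mem_cons_self, ht⟩, freed P u v τ, ?_, by simp [freed, hb]⟩⟩
      rw [← ht]
      exact updateFree_of_mem hself hτ
    · have h' := h.evaluate_free (f := s.finished) hx hx0 hτ hb hp hc hlow id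
        fun h => absurd h ht
      have hl' : ∀ e ∈ es, ∃ τ, updateFree P s.tree u v e.2 = some τ ∧
          P.IsLower s.edges e.2 τ.key := by
        intro e he
        obtain ⟨ρ, hρ, hρl⟩ := hl e (List.mem_cons_of_mem _ he)
        by_cases hm : e.2 ∈ subtree s.tree v
        · exact ⟨_, updateFree_of_mem hm hρ, by rwa [freed_key]⟩
        · exact ⟨ρ, by rw [updateFree_of_not_mem hm, hρ], hρl⟩
      obtain ⟨h1, h2⟩ := ih h' hf (updateFree_of_mem hself hτ) (by simp [freed, hb])
        (hpath.updateFree hself) hl'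
      refine ⟨h1, fun hfin => ?_⟩
      obtain ⟨h3, ⟨e, he, het⟩, h4⟩ := h2 hfin
      exact ⟨h3, ⟨e, List.mem_cons_of_mem _ he, het⟩, h4⟩

/-! ### Best offers and fully extended states. -/

/-- No vertex has an offer: the search tree is fully extended. -/
def IsExtended (P : SPProblem V) (α : ℕ∞) (s : LRAState V) : Prop :=
  ∀ p τ v, ¬ Offers P α s p τ v

theorem exists_bestOffer [Finite V] {S : Set V} {p v : V} {τ : LRANode V} (hv : v ∈ S)
    (ho : Offers P α s p τ v) : ∃ o, BestOffer P α s S o := by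
  let O : Set (V × LRANode V × V) := {o | o.2.2 ∈ S ∧ Offers P α s o.1 o.2.1 o.2.2}
  have hO : O.Finite := by
    -- The node in an offer is determined by its vertex, so there are only finitely many offers.
    refine Set.Finite.of_finite_image (f := fun o => (o.1, o.2.2)) (Set.toFinite _) ?_
    rintro ⟨p, τ, v⟩ h ⟨p', τ', v'⟩ h' heq
    simp only [Prod.mk.injEq] at heq
    obtain ⟨rfl, rfl⟩ := heq
    have := h.2.1.symm.trans h'.2.1
    simp only [Option.some.injEq] at this
    rw [this]
  obtain ⟨o, ho, hmin⟩ := hO.exists_minimalFor (fun o => (child P o.2.1 o.1 o.2.2).key) O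
    ⟨(p, τ, v), hv, ho⟩
  refine ⟨o, ho.1, ho.2, fun q σ x hx hq => ?_⟩
  exact le_of_not_gt fun hlt => absurd (hmin (j := (q, σ, x)) ⟨hx, hq⟩ hlt.le) (not_le.2 hlt)

theorem exists_isMinFrontier [Finite V] {v : V} {τ : LRANode V} (h : InFrontier P α s v τ) :
    ∃ w, IsMinFrontier P α s w := by
  let O : Set V := {v | ∃ τ, InFrontier P α s v τ}
  obtain ⟨w, ⟨σ, hσ⟩, hmin⟩ := (Set.toFinite O).exists_minimalFor
    (fun x => (s.tree x).elim 0 LRANode.key) O ⟨v, τ, h⟩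
  refine ⟨w, σ, hσ, fun x ρ hρ => ?_⟩
  have key : ∀ x ρ, InFrontier P α s x ρ → (s.tree x).elim 0 LRANode.key = ρ.key :=
    fun x ρ hρ => by simp [hρ.1]
  refine le_of_not_gt fun hlt => ?_
  have := hmin (j := x) ⟨ρ, hρ⟩
  simp only [key _ _ hσ, key _ _ hρ] at this
  exact absurd (this hlt.le) (not_le.2 hlt)

/-- In a fully extended state, a walk from the source is bounded below by the node of its end or
by a frontier node. -/
theorem Inv.exists_key_le (h : Inv P α s) (hext : IsExtended P α s) {v : V} {c : ℝ}
    (hr : P.Reach s.edges v c) : (∃ τ, s.tree v = some τ ∧ τ.key ≤ c) ∨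
      ∃ w τ, InFrontier P α s w τ ∧ τ.key ≤ c := by
  induction hr with
  | source => exact .inl ⟨_, h.root, by simp [LRANode.key]⟩
  | @step p v c _ he ih =>
    have hpos := h.lazyCost_pos he
    rcases ih with ⟨τ, hτ, hk⟩ | ⟨w, τ, hw, hk⟩
    · by_cases hfr : InFrontier P α s p τ
      · exact .inr ⟨p, τ, hfr, by linarith⟩
      · simp only [InFrontier, hτ, true_and, not_or] at hfr
        -- A node off the frontier has budget below `α` and is not the target's, so only a
        -- sufficiently cheap node of `v` can prevent its offer.
        have := hext p τ v
        simp only [Offers, hτ, true_and, he, not_and, not_forall, child_key] at this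
        obtain ⟨σ, hσ, hlt⟩ := this hfr.2 (lt_of_le_of_ne (h.budget_le p τ hτ) hfr.1)
        exact .inl ⟨σ, hσ, by linarith⟩
    · exact .inr ⟨w, τ, hw, by linarith⟩

theorem Inv.exists_frontier_of_reach_target (h : Inv P α s) (hext : IsExtended P α s) {c : ℝ}
    (hr : P.Reach s.edges P.target c) : ∃ w τ, InFrontier P α s w τ ∧ τ.key ≤ c := by
  rcases h.exists_key_le hext hr with ⟨τ, hτ, hk⟩ | h'
  · exact ⟨_, τ, ⟨hτ, .inr rfl⟩, hk⟩
  · exact h'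

/-- The path to a frontier node of minimal key is a cheapest one. -/
theorem Inv.isLower_of_min (h : Inv P α s) (hext : IsExtended P α s) {v : V} {τ : LRANode V}
    (hv : s.tree v = some τ) (hmin : ∀ v' τ', InFrontier P α s v' τ' → τ.key ≤ τ'.key) :
    P.IsLower s.edges v τ.key := by
  intro c hr
  rcases h.exists_key_le hext hr with ⟨τ', hτ', hk⟩ | ⟨w, τ', hw, hk⟩
  · rw [hv] at hτ'
    cases hτ'
    exact hk
  · exact (hmin w τ' hw).trans hk

end LRAState

/-! ### The run: case analysis of a step, termination, terminal states. -/

namespace LRAState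

variable {V : Type*} {P : SPProblem V} {α : ℕ∞} {s : LRAState V}

theorem takeFirst_one_cons {A : Type*} (a : A) (l : List A) : takeFirst 1 (a :: l) = [a] := by
  have : min (1 : ℕ∞) ((a :: l).length : ℕ∞) = 1 := by
    rw [min_eq_left]
    exact_mod_cast Nat.succ_le_succ (Nat.zero_le _)
  simp [takeFirst, -List.length_cons, this]

theorem exists_takeFirst_cons {A : Type*} {β : ℕ∞} (hβ : 1 ≤ β) (a : A) (l : List A) :
    ∃ m, takeFirst β (a :: l) = a :: m := by
  have h1 : (1 : ℕ∞) ≤ min β ((a :: l).length : ℕ∞) :=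
    le_min hβ (by exact_mod_cast Nat.succ_le_succ (Nat.zero_le _))
  have h2 : min β ((a :: l).length : ℕ∞) ≠ ⊤ :=
    ne_top_of_le_ne_top (ENat.natCast_ne_top _) (min_le_right _ _)
  have h3 : 1 ≤ (min β ((a :: l).length : ℕ∞)).toNat := by
    rw [← ENat.natCast_toNat h2] at h1
    exact_mod_cast h1
  obtain ⟨n, hn⟩ := Nat.exists_eq_add_of_le' h3
  refine ⟨l.take n, ?_⟩
  unfold takeFirst
  rw [hn, List.take_succ_cons]

/-- Hides the choice made by `step`: later arguments use only that the chosen offer or frontier node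
is a best one. Finiteness turns the absence of a best one into the absence of any. -/
theorem step_cases [Finite V] (P : SPProblem V) (α β : ℕ∞) (s : LRAState V) :
    (s.finished ∧ step P α β s = s) ∨
    (¬ s.finished ∧
      ((∃ o, BestOffer P α s s.pending o ∧ step P α β s = attach P s o) ∨
      (s.pending.Nonempty ∧ step P α β s = { s with pending := ∅ }) ∨
      (s.pending = ∅ ∧ ∃ o, BestOffer P α s Set.univ o ∧ step P α β s = attach P s o) ∨
      (s.pending = ∅ ∧ IsExtended P α s ∧
        ((∃ w, IsMinFrontier P α s w ∧
          step P α β s = evaluateEdges P s (takeFirst β (tail s.tree w))) ∨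
        ((∀ w τ, ¬ InFrontier P α s w τ) ∧ step P α β s = s))))) := by
  by_cases hf : s.finished
  · exact .inl ⟨hf, by simp [step, hf]⟩
  refine .inr ⟨hf, ?_⟩
  by_cases h1 : ∃ o, BestOffer P α s s.pending o
  · exact .inl ⟨h1.choose, h1.choose_spec, by simp only [step, if_neg hf, dif_pos h1]⟩
  refine .inr ?_
  by_cases h2 : s.pending.Nonempty
  · exact .inl ⟨h2, by simp only [step, if_neg hf, dif_neg h1, if_pos h2]⟩
  have h2' := Set.not_nonempty_iff_eq_empty.1 h2
  refine .inr ?_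
  by_cases h3 : ∃ o, BestOffer P α s Set.univ o
  · exact .inl ⟨h2', h3.choose, h3.choose_spec,
      by simp only [step, if_neg hf, dif_neg h1, if_neg h2, dif_pos h3]⟩
  refine .inr ⟨h2', fun p τ v ho => h3 (exists_bestOffer (Set.mem_univ v) ho), ?_⟩
  by_cases h4 : ∃ w, IsMinFrontier P α s w
  · exact .inl ⟨h4.choose, h4.choose_spec,
      by simp only [step, if_neg hf, dif_neg h1, if_neg h2, dif_neg h3, dif_pos h4]⟩
  · exact .inr ⟨fun w τ hw => h4 (exists_isMinFrontier hw),
      by simp only [step, if_neg hf, dif_neg h1, if_neg h2, dif_neg h3, dif_neg h4]⟩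

/-- The nodes that are final within an extension phase: no offer undercuts them. -/
def settled (P : SPProblem V) (α : ℕ∞) (s : LRAState V) : Set V :=
  {v | ∃ σ, s.tree v = some σ ∧ ∀ p τ x, Offers P α s p τ x → σ.key ≤ (child P τ p x).key}

/-- As in Dijkstra's algorithm, positive costs and the choice of a best offer ensure that no later
offer is cheaper. So `v` becomes settled, which it was not before, and no settled node is among
those removed. -/
theorem Inv.settled_ssubset [Finite V] (h : Inv P α s) {o : V × LRANode V × V}
    (ho : BestOffer P α s Set.univ o) : settled P α s ⊂ settled P α (LRAState.attach P s o) := by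
  obtain ⟨p, τ, v⟩ := o
  obtain ⟨-, ho, hmin⟩ := ho
  simp only [Set.mem_univ, true_implies] at ho hmin
  have hlate : ∀ q σ x, Offers P α (LRAState.attach P s (p, τ, v)) q σ x →
      (child P τ p v).key ≤ (child P σ q x).key := by
    rintro q σ x ⟨hq, hqt, hb, he, hk⟩
    rcases attach_tree_cases hq with ⟨rfl, rfl⟩ | ⟨hqm, hq⟩
    · have := h.lazyCost_pos he
      rw [child_key _ (child P τ p q)]
      linarith
    · by_cases hold : ∀ ρ, s.tree x = some ρ → (child P σ q x).key < ρ.key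
      · exact hmin q σ x ⟨hq, hqt, hb, he, hold⟩
      · push Not at hold
        obtain ⟨ρ, hρ, hle⟩ := hold
        -- The offer is new, so `x` must have lost its node with the subtree of `v`; that node had
        -- at least the old key of `v`, which exceeds the best offer.
        by_cases hx : x ∈ subtree s.tree v
        · obtain ⟨ρ', hρ', h1, -⟩ := h.of_mem_subtree hx hρ
          have := ho.2.2.2.2 ρ' hρ'
          linarith
        · have := hk ρ (by rw [attach_tree_of_not_mem _ _ _ _ _ _ hx, hρ])
          linarith
  refine (Set.ssubset_iff_of_subset ?_).2 ⟨v, ⟨_, attach_tree_self .., hlate⟩, ?_⟩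
  · rintro x ⟨σ, hσ, hle⟩
    have hk := hle p τ v ho
    refine ⟨σ, ?_, fun q ρ y hq => hk.trans (hlate q ρ y hq)⟩
    rw [attach_tree_of_not_mem _ _ _ _ _ _ ?_, hσ]
    intro hx
    obtain ⟨ρ, hρ, h1, -⟩ := h.of_mem_subtree hx hσ
    have := ho.2.2.2.2 ρ hρ
    linarith
  · rintro ⟨σ, hσ, hle⟩
    exact absurd (ho.2.2.2.2 σ hσ) (not_lt.2 (hle p τ v ho))

/-- The extension phase ends. -/
theorem Inv.exists_extended_of_pending_eq_empty [Finite V] (β : ℕ∞) (h : Inv P α s)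
    (hf : ¬ s.finished) (hp : s.pending = ∅) : ∃ k, Inv P α ((step P α β)^[k] s) ∧
      ¬ ((step P α β)^[k] s).finished ∧ ((step P α β)^[k] s).pending = ∅ ∧
      IsExtended P α ((step P α β)^[k] s) ∧
      ((step P α β)^[k] s).evaluated = s.evaluated := by
  induction hn : (settled P α s)ᶜ.ncard using Nat.strong_induction_on generalizing s with
  | _ n ih =>
    rcases step_cases P α β s with ⟨h', -⟩ | ⟨-, ⟨o, ho, -⟩ | ⟨h', -⟩ | ⟨-, o, ho, hs⟩ |
      ⟨-, hext, -⟩⟩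
    · exact absurd h' hf
    · rw [hp] at ho
      exact absurd ho.1 (Set.notMem_empty _)
    · rw [hp] at h'
      exact absurd h' Set.not_nonempty_empty
    · have hlt : (settled P α (LRAState.attach P s o))ᶜ.ncard < n := by
        rw [← hn]
        exact Set.ncard_lt_ncard (compl_lt_compl_iff_lt.2 (h.settled_ssubset ho))
      obtain ⟨k, hk⟩ := ih _ hlt (h.attach ho.2.1) hf (by simp [LRAState.attach, hp]) rfl
      refine ⟨k + 1, ?_⟩
      rw [Function.iterate_succ_apply, hs]
      exact hk
    · exact ⟨0, h, hf, hp, hext, rfl⟩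

/-- Rewiring and extending end. -/
theorem Inv.exists_extended [Finite V] (β : ℕ∞) (h : Inv P α s) (hf : ¬ s.finished) :
    ∃ k, Inv P α ((step P α β)^[k] s) ∧ ¬ ((step P α β)^[k] s).finished ∧
      ((step P α β)^[k] s).pending = ∅ ∧ IsExtended P α ((step P α β)^[k] s) ∧
      ((step P α β)^[k] s).evaluated = s.evaluated := by
  induction hn : s.pending.ncard using Nat.strong_induction_on generalizing s with
  | _ n ih =>
    by_cases hp : s.pending = ∅
    · exact h.exists_extended_of_pending_eq_empty β hf hp
    rcases step_cases P α β s with ⟨h', -⟩ | ⟨-, ⟨o, ho, hs⟩ | ⟨-, hs⟩ | ⟨h', -⟩ | ⟨h', -⟩⟩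
    · exact absurd h' hf
    · have hlt : (LRAState.attach P s o).pending.ncard < n := by
        rw [← hn]
        exact Set.ncard_lt_ncard
          ((Set.ssubset_iff_of_subset Set.sdiff_subset).2 ⟨o.2.2, ho.1, by simp⟩)
      obtain ⟨k, hk⟩ := ih _ hlt (h.attach ho.2.1) hf rfl
      refine ⟨k + 1, ?_⟩
      rw [Function.iterate_succ_apply, hs]
      exact hk
    · obtain ⟨k, hk⟩ := (h.with_pending ∅).exists_extended_of_pending_eq_empty β hf rfl
      refine ⟨k + 1, ?_⟩
      rw [Function.iterate_succ_apply, hs]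
      exact hk
    · exact absurd h' hp
    · exact absurd h' hp

/-- The target of the finished state `f` has been reached through a path that is at most as long
as all frontier paths of the fully extended state from which the last path was chosen. -/
def Returned (P : SPProblem V) (α : ℕ∞) (f : LRAState V) : Prop :=
  ∃ g, Inv P α g ∧ IsExtended P α g ∧ g.edges = f.edges ∧ g.evaluated ⊆ f.evaluated ∧
    ∃ τ, f.tree P.target = some τ ∧ τ.budget = 0 ∧ ∀ w ρ, InFrontier P α g w ρ → τ.key ≤ ρ.key

theorem Inv.evaluate_min [Finite V] (β : ℕ∞) (h : Inv P α s) (hf : ¬ s.finished)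
    (hext : IsExtended P α s) {w : V} (hw : IsMinFrontier P α s w) :
    Inv P α (LRAState.evaluateEdges P s (takeFirst β (tail s.tree w))) ∧
      ((LRAState.evaluateEdges P s (takeFirst β (tail s.tree w))).finished →
        Returned P α (LRAState.evaluateEdges P s (takeFirst β (tail s.tree w)))) := by
  obtain ⟨τ, ⟨hτ, -⟩, hmin⟩ := hw
  have hmem := h.of_mem_tail hτ (h.isLower_of_min hext hτ hmin)
  obtain ⟨-, x, σ, hσ, hσ0, hpath⟩ := h.isBandPath_tail hτ
  have hsub : ∀ e ∈ takeFirst β (tail s.tree w), e ∈ tail s.tree w :=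
    fun e he => List.mem_of_mem_take he
  obtain ⟨y, hy⟩ := hpath.take (min β ((tail s.tree w).length : ℕ∞)).toNat
  obtain ⟨h1, h2⟩ := h.evaluateEdges hf hσ hσ0 hy fun e he =>
    let ⟨ρ, hρ, _, hρl⟩ := hmem e (hsub e he)
    ⟨ρ, hρ, hρl⟩
  refine ⟨h1, fun hfin => ?_⟩
  obtain ⟨hedges, ⟨e, he, het⟩, ρ, hρ, hρ0⟩ := h2 hfin
  refine ⟨s, h, hext, hedges.symm, subset_evaluateEdges .., ρ, hρ, hρ0, fun v σ' hv => ?_⟩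
  obtain ⟨ρ', hρ', hle, -⟩ := hmem e (hsub e he)
  rw [het] at hρ'
  -- The target lies on the selected path, and its old node yields a walk in the unchanged graph,
  -- which cannot beat the evaluated path.
  have := h1.lower _ _ hρ hρ0 ρ'.key (by
    rw [hedges]
    exact h.reach hρ')
  exact this.trans (hle.trans (hmin v σ' hv))

theorem Inv.step [Finite V] (β : ℕ∞) (h : Inv P α s) (hr : s.finished → Returned P α s) :
    Inv P α (step P α β s) ∧ ((step P α β s).finished → Returned P α (step P α β s)) := by
  rcases step_cases P α β s with ⟨-, hs⟩ | ⟨hf, ⟨o, ho, hs⟩ | ⟨-, hs⟩ | ⟨-, o, ho, hs⟩ |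
      ⟨-, hext, ⟨w, hw, hs⟩ | ⟨-, hs⟩⟩⟩ <;> rw [hs]
  · exact ⟨h, hr⟩
  · exact ⟨h.attach ho.2.1, fun h' => absurd h' hf⟩
  · exact ⟨h.with_pending _, fun h' => absurd h' hf⟩
  · exact ⟨h.attach ho.2.1, fun h' => absurd h' hf⟩
  · exact h.evaluate_min β hf hext hw
  · exact ⟨h, hr⟩

theorem inv_iterate [Finite V] (P : SPProblem V) (α β : ℕ∞) (k : ℕ) :
    Inv P α ((step P α β)^[k] (init P)) ∧ (((step P α β)^[k] (init P)).finished →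
      Returned P α ((step P α β)^[k] (init P))) := by
  induction k with
  | zero => exact ⟨.init P α, fun h => absurd h id⟩
  | succ k ih =>
    rw [Function.iterate_succ_apply']
    exact ih.1.step β ih.2

theorem subset_step [Finite V] (P : SPProblem V) (α β : ℕ∞) (s : LRAState V) :
    s.evaluated ⊆ (step P α β s).evaluated := by
  rcases step_cases P α β s with ⟨-, hs⟩ | ⟨hf, ⟨o, ho, hs⟩ | ⟨-, hs⟩ | ⟨-, o, ho, hs⟩ |
      ⟨-, hext, ⟨w, hw, hs⟩ | ⟨-, hs⟩⟩⟩ <;> rw [hs]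
  · exact subset_rfl
  · exact subset_rfl
  · exact subset_evaluateEdges ..

/-- The first edge of a tail has not been evaluated. -/
theorem Inv.not_mem_evaluated (h : Inv P α s) {u v : V} {τ : LRANode V} (hv : s.tree v = some τ)
    (hp : τ.parent = some u) (h0 : τ.budget ≠ 0) : (u, v) ∉ s.evaluated := by
  intro hm
  obtain ⟨σ, -, he, -⟩ := h.of_parent hv hp
  by_cases hc : P.inCollision u v
  · exact ((h.mem_edges u v).1 he).2 ⟨hm, hc⟩
  · obtain ⟨τ', hτ', -, hb⟩ := h.child_head u v hm hc
    rw [hv] at hτ'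
    cases hτ'
    exact h0 hb

/-- The run comes to an end: the target is returned, or there is no frontier node any more. -/
theorem exists_terminal [Finite V] (P : SPProblem V) {α β : ℕ∞} (hα : 1 ≤ α) (hβ : 1 ≤ β)
    (hst : P.target ≠ P.source) : ∃ f, Inv P α f ∧ f.evaluated = LRAEvaluatedEdges P α β ∧
      (Returned P α f ∨ (IsExtended P α f ∧ ∀ w τ, ¬ InFrontier P α f w τ)) := by
  have hmono : Monotone fun k => ((step P α β)^[k] (LRAState.init P)).evaluated := by
    refine monotone_nat_of_le_succ fun k => ?_
    rw [Function.iterate_succ_apply']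
    exact subset_step ..
  -- There are finitely many pairs of vertices, so the evaluated sets are constant from some `n` on.
  obtain ⟨n, hn⟩ := WellFoundedGT.monotone_chain_condition (⟨_, hmono⟩ : ℕ →o Set (V × V))
  simp only [OrderHom.coe_mk] at hn
  have hE : ∀ m, n ≤ m →
      ((step P α β)^[m] (LRAState.init P)).evaluated = LRAEvaluatedEdges P α β := by
    intro m hm
    refine Set.Subset.antisymm (fun e he => ⟨m, he⟩) ?_
    rintro e ⟨k, hk⟩
    rw [← hn m hm, hn (max n k) (le_max_left _ _)]
    exact hmono (le_max_right n k) hk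
  obtain ⟨hinv, hret⟩ := inv_iterate P α β n
  by_cases hf : ((step P α β)^[n] (LRAState.init P)).finished
  · exact ⟨_, hinv, hE n le_rfl, .inl (hret hf)⟩
  obtain ⟨k, h1, h2, h3, h4, -⟩ := hinv.exists_extended β hf
  rw [← Function.iterate_add_apply] at h1 h2 h3 h4
  refine ⟨_, h1, hE (k + n) (Nat.le_add_left _ _), .inr ⟨h4, ?_⟩⟩
  -- One more step evaluates nothing new. Since selecting a frontier node would evaluate a fresh
  -- edge, the frontier must be empty.
  have hsucc := hE (k + n + 1) (by omega)
  rw [← hE (k + n) (Nat.le_add_left _ _), Function.iterate_succ_apply'] at hsucc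
  set t := (step P α β)^[k + n] (LRAState.init P) with ht
  rcases step_cases P α β t with ⟨h', -⟩ | ⟨-, ⟨o, ho, -⟩ | ⟨h', -⟩ | ⟨-, o, ho, hs⟩ |
      ⟨-, -, ⟨w, hw, hs⟩ | ⟨h', -⟩⟩⟩
  · exact absurd h' h2
  · exact absurd ho.2.1 (h4 _ _ _)
  · rw [h3] at h'
    exact absurd h' Set.not_nonempty_empty
  · exact absurd ho.2.1 (h4 _ _ _)
  · exfalso
    obtain ⟨τ, ⟨hτ, hfr⟩, -⟩ := hw
    obtain ⟨hlen, x, σ, -, -, hpath⟩ := h1.isBandPath_tail hτ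
    match htail : tail t.tree w with
    | [] =>
      rw [htail] at hlen
      -- An empty tail is impossible on the frontier: `α` is positive, and an unfinished run has no
      -- evaluated path to a target other than the source.
      have h0 : τ.budget = 0 := hlen.symm
      rcases hfr with hfr | rfl
      · rw [← hfr, h0] at hα
        simp at hα
      · exact hst (h1.not_finished τ hτ h0 h2)
    | (u, v) :: es =>
      rw [htail] at hpath hs
      obtain ⟨rfl, ⟨ρ, hρ, hp, hb⟩, -⟩ := hpath
      obtain ⟨m, hm⟩ := exists_takeFirst_cons hβ (u, v) es
      have := mem_evaluateEdges P t (u, v) m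
      rw [← hm, ← hs, hsucc] at this
      exact h1.not_mem_evaluated hρ hp (by omega) this
  · exact h'

end LRAState

/-! ### Comparison of the two runs. -/

namespace LRAState

variable {V : Type*} {P : SPProblem V} {α : ℕ∞} {s f g : LRAState V}

theorem Inv.edges_anti (hs : Inv P α s) (hf : Inv P α f) (hsf : s.evaluated ⊆ f.evaluated) :
    f.edges ⊆ s.edges := by
  rintro ⟨u, v⟩ h
  rw [hf.mem_edges] at h
  rw [hs.mem_edges]
  exact ⟨h.1, fun h' => h.2 ⟨hsf h'.1, h'.2⟩⟩

/-- Evaluated paths of `s` are evaluated paths of every state in which more is evaluated. -/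
theorem Inv.exists_budget_eq_zero [Finite V] (hs : Inv P α s) (hf : Inv P α f)
    (hsf : s.evaluated ⊆ f.evaluated) {v : V} {τ : LRANode V} (hv : s.tree v = some τ)
    (h0 : τ.budget = 0) : ∃ σ, f.tree v = some σ ∧ σ.budget = 0 ∧ σ.key = τ.key := by
  refine hs.tree_induction (motive := fun v τ => τ.budget = 0 →
    ∃ σ, f.tree v = some σ ∧ σ.budget = 0 ∧ σ.key = τ.key) ?_ ?_ v τ hv h0
  · exact fun _ => ⟨_, hf.root, rfl, rfl⟩
  · intro p σ v τ hσ hv hp ih h0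
    obtain ⟨σ', hσ', he, -, hkey, hb⟩ := hs.of_parent hv hp
    simp only [hσ, Option.some.injEq] at hσ'
    subst hσ'
    obtain ⟨-, hσ0, hev⟩ := hb.resolve_right (by omega)
    have hc : ¬ P.inCollision p v := fun hc => ((hs.mem_edges p v).1 he).2 ⟨hev, hc⟩
    -- The evaluated, collision-free edge from `p` to `v` is also a head edge of the tree of `f`, so
    -- the two heads agree edge by edge.
    obtain ⟨ρ, hρ, hρp, hρ0⟩ := hf.child_head p v (hsf hev) hc
    obtain ⟨π, hπ, -, -, hkey', -⟩ := hf.of_parent hρ hρp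
    obtain ⟨π', hπ', -, hk⟩ := ih hσ0
    simp only [hπ, Option.some.injEq] at hπ'
    subst hπ'
    exact ⟨ρ, hρ, hρ0, by rw [hkey', hk, hkey]⟩

/-- The child of a vertex along a cheapest path whose last edge is not evaluated in `f`. -/
theorem Inv.unevaluated_step [Finite V] (hP : P.NoTies) (hs : Inv P α s) (hf : Inv P α f)
    (hfs : f.edges ⊆ s.edges) {x y : V} {σ τ : LRANode V} (hx : s.tree x = some σ)
    (hy : s.tree y = some τ) (hp : τ.parent = some x) (hl : P.IsLower s.edges y τ.key)
    (hr : P.Reach f.edges x σ.key) (hxy : (x, y) ∉ f.evaluated) :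
    (x, y) ∈ f.edges ∧ P.Reach f.edges y τ.key ∧
      ∀ ρ, f.tree y = some ρ → ρ.budget ≠ 0 := by
  obtain ⟨σ', hσ', he, -, hkey, -⟩ := hs.of_parent hy hp
  simp only [hx, Option.some.injEq] at hσ'
  subst hσ'
  have hef : (x, y) ∈ f.edges := (hf.mem_edges x y).2 ⟨hs.adj _ he, fun h => hxy h.1⟩
  rw [hkey] at hl ⊢
  have hl' := hl.anti hfs
  refine ⟨hef, hr.step hef, fun ρ hρ h0 => ?_⟩
  obtain ⟨q, π, hq, hπ, heq, -, hkey', hb⟩ := hf.parent y ρ hρ (hs.ne_source_of_parent hy hp)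
  obtain ⟨-, -, hev⟩ := hb.resolve_right (by omega)
  have h1 := hf.lower y ρ hρ h0 _ (hr.step hef)
  have h2 := hl' _ (hf.reach hρ)
  -- An evaluated path of `f` to `y` would be cheapest too, so its last edge would be the
  -- unevaluated one.
  have := hP.pred_unique hf.adj hr (hf.reach hπ) hef heq hl' (by linarith)
  subst this
  exact hxy hev

/-- The search tree of `g` contains the cheapest path to `x`, of cost `c`, with at least `b` edges
in its tail, or a frontier node whose key is at most `c`. -/
def Covered (P : SPProblem V) (α : ℕ∞) (g : LRAState V) (b : ℕ) (x : V) (c : ℝ) : Prop :=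
  (∃ ρ, g.tree x = some ρ ∧ ρ.key = c ∧ b ≤ ρ.budget) ∨
    ∃ w ρ, InFrontier P α g w ρ ∧ ρ.key ≤ c

/-- Unless a cheap frontier node exists, full extension gives `y` a node of the least possible key.
Its parent is then `x` by uniqueness, and the budget grows by one because the edge is not evaluated.
-/
theorem Inv.covered_step [Finite V] (hP : P.NoTies) (hg : Inv P α g) (hext : IsExtended P α g)
    {b : ℕ} {x y : V} {c : ℝ} (hx : P.Reach g.edges x c) (he : (x, y) ∈ g.edges)
    (hys : y ≠ P.source) (hl : P.IsLower g.edges y (c + P.lazyCost x y))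
    (hxy : (x, y) ∉ g.evaluated) (hc : Covered P α g b x c) :
    Covered P α g (b + 1) y (c + P.lazyCost x y) := by
  have hpos := hg.lazyCost_pos he
  rcases hc with ⟨ρ, hρ, hk, hb⟩ | ⟨w, ρ, hw, hk⟩
  · rcases hg.exists_key_le hext (hx.step he) with ⟨π, hπ, hle⟩ | h
    · left
      have hπk : π.key = c + P.lazyCost x y := le_antisymm hle (hl _ (hg.reach hπ))
      obtain ⟨q, θ, hq, hθ, heq, -, hkey, hbud⟩ := hg.parent y π hπ hys
      have := hP.pred_unique hg.adj hx (hg.reach hθ) he heq hl (by linarith)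
      subst this
      simp only [hρ, Option.some.injEq] at hθ
      subst hθ
      refine ⟨π, hπ, hπk, ?_⟩
      rw [hbud.resolve_left fun h => hxy h.2.2]
      omega
    · exact .inr h
  · exact .inr ⟨w, ρ, hw, by linarith⟩

/-- Follows the tail chosen in `s` through `f` and `g`. Only the first edge is assumed unevaluated;
the induction passes this on to the next edge. The hypothesis `hnil` covers the end of the list,
where no edge is left to show that the vertex is unevaluated. -/
theorem IsBandPath.covered [Finite V] (hP : P.NoTies) (hs : Inv P α s) (hf : Inv P α f)
    (hg : Inv P α g) (hext : IsExtended P α g) (hfs : f.edges ⊆ s.edges)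
    (hgf : g.edges = f.edges) (hgf' : g.evaluated ⊆ f.evaluated) {b : ℕ} {x z : V}
    {es : List (V × V)} (hes : IsBandPath s.tree b x es z)
    (hl : ∀ e ∈ es, ∃ τ, s.tree e.2 = some τ ∧ P.IsLower s.edges e.2 τ.key) {σ : LRANode V}
    (hx : s.tree x = some σ) (hr : P.Reach f.edges x σ.key) (hc : Covered P α g b x σ.key)
    (hnext : ∀ e ∈ es.head?, e ∉ f.evaluated)
    (hnil : es = [] → ∀ ρ, f.tree x = some ρ → ρ.budget ≠ 0) :
    ∃ τ, s.tree z = some τ ∧ P.Reach f.edges z τ.key ∧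
      Covered P α g (b + es.length) z τ.key ∧ ∀ ρ, f.tree z = some ρ → ρ.budget ≠ 0 := by
  induction es generalizing b x σ with
  | nil =>
    cases hes
    exact ⟨σ, hx, hr, hc, hnil rfl⟩
  | cons e es ih =>
    obtain ⟨u, y⟩ := e
    obtain ⟨rfl, ⟨τ, hτ, hp, hb⟩, hpath⟩ := hes
    obtain ⟨τ', hτ', hlow⟩ := hl (u, y) List.mem_cons_self
    simp only [hτ, Option.some.injEq] at hτ'
    subst hτ'
    have hxy := hnext (u, y) rfl
    obtain ⟨he, hr', h0⟩ := hs.unevaluated_step hP hf hfs hx hτ hp hlow hr hxy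
    obtain ⟨σ', hσ', -, -, hkey, -⟩ := hs.of_parent hτ hp
    simp only [hx, Option.some.injEq] at hσ'
    subst hσ'
    rw [← hgf] at hr he hfs
    have hc' : Covered P α g (b + 1) y τ.key := by
      rw [hkey] at hlow ⊢
      exact hg.covered_step hP hext hr he (hs.ne_source_of_parent hτ hp) (hlow.anti hfs)
        (fun h => hxy (hgf' h)) hc
    have := ih hpath (fun e he => hl e (List.mem_cons_of_mem _ he)) hτ hr' hc' ?_ fun _ => h0
    · rw [List.length_cons, add_comm es.length, ← add_assoc]
      exact this
    · rintro ⟨p, q⟩ hpq hev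
      cases es with
      | nil => simp at hpq
      | cons e es =>
        simp only [List.head?_cons, Option.mem_def, Option.some.injEq] at hpq
        subst hpq
        obtain ⟨rfl, -⟩ := hpath
        -- An evaluated next edge would start at a vertex of budget 0 in `f`, but `y` is not one.
        obtain ⟨ρ, hρ, hρ0⟩ := hf.head _ _ hev
        exact h0 ρ hρ hρ0

/-- The first edge of the tail of the path that is chosen in `s` has been evaluated in every
terminal state `f` in which at least as much is evaluated as in `s`. -/
theorem Inv.mem_evaluated_of_terminal [Finite V] (hP : P.NoTies) (hs : Inv P α s)
    (hext : IsExtended P α s) (hf : Inv P α f)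
    (hterm : Returned P α f ∨ (IsExtended P α f ∧ ∀ w τ, ¬ InFrontier P α f w τ))
    (hsf : s.evaluated ⊆ f.evaluated) {w : V} (hw : IsMinFrontier P α s w) {u v : V}
    {es : List (V × V)} (htail : tail s.tree w = (u, v) :: es) : (u, v) ∈ f.evaluated := by
  by_contra hnot
  have hfs := hs.edges_anti hf hsf
  obtain ⟨τ, ⟨hτ, hfr⟩, hmin⟩ := hw
  have hlow := hs.isLower_of_min hext hτ hmin
  obtain ⟨hlen, x, σ, hx, hx0, hpath⟩ := hs.isBandPath_tail hτ
  have hmem := hs.of_mem_tail hτ hlow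
  rw [htail] at hlen hpath hmem
  obtain ⟨σ', hσ', -, hkey⟩ := hs.exists_budget_eq_zero hf hsf hx hx0
  have hr : P.Reach f.edges x σ.key := hkey ▸ hf.reach hσ'
  have hxl := (hs.lower x σ hx hx0).anti hfs
  -- Stated for general `g` to serve both kinds of terminal state: the state of the last selection,
  -- and `f` itself.
  have key : ∀ g, Inv P α g → IsExtended P α g → g.edges = f.edges →
      g.evaluated ⊆ f.evaluated → P.Reach f.edges w τ.key ∧
      (∃ z ρ, InFrontier P α g z ρ ∧ ρ.key ≤ τ.key) ∧
      ∀ ρ, f.tree w = some ρ → ρ.budget ≠ 0 := by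
    intro g hg hgext hgf hgf'
    have hc : Covered P α g 0 x σ.key := by
      rcases hg.exists_key_le hgext (hgf ▸ hr) with ⟨ρ, hρ, hle⟩ | h
      · exact .inl ⟨ρ, hρ, le_antisymm hle (hxl _ (hgf ▸ hg.reach hρ)), Nat.zero_le _⟩
      · exact .inr h
    obtain ⟨τ', hτ', h1, h2, h3⟩ := hpath.covered hP hs hf hg hgext hfs hgf hgf'
      (fun e he => let ⟨ρ, hρ, _, hρl⟩ := hmem e he; ⟨ρ, hρ, hρl⟩) hx hr hc
      (by rintro e he; cases he; exact hnot) (fun h => absurd h (List.cons_ne_nil _ _))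
    rw [hτ] at hτ'
    cases hτ'
    refine ⟨h1, ?_, h3⟩
    rcases h2 with ⟨ρ, hρ, hk, hb⟩ | h
    · refine ⟨w, ρ, ⟨hρ, ?_⟩, hk.le⟩
      -- The budget in `g` is at least the length of the tail in `s`. If that is `α`, the bound
      -- `budget_le` forces equality.
      refine hfr.imp_left fun h => le_antisymm (hg.budget_le w ρ hρ) ?_
      rw [← h, ← hlen]
      exact_mod_cast (by simpa using hb)
    · exact h
  rcases hterm with ⟨g, hg, hgext, hgf, hgf', ρ, hρ, hρ0, hle⟩ | ⟨hfext, hno⟩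
  · obtain ⟨hrw, ⟨z, π, hz, hπ⟩, hw0⟩ := key g hg hgext hgf hgf'
    have h1 : ρ.key ≤ τ.key := (hle z π hz).trans hπ
    have hrt := hf.reach hρ
    -- The returned path is a walk in the larger graph of `s`, so the minimality of `w` gives the
    -- reverse inequality.
    obtain ⟨y, θ, hy, hθ⟩ := hs.exists_frontier_of_reach_target hext (hrt.mono hfs)
    have h2 : τ.key = ρ.key := le_antisymm ((hmin y θ hy).trans hθ) h1
    have := hP.eq_of_dist_eq hf.adj hrw (h2 ▸ hrt) (hlow.anti hfs) (h2 ▸ hf.lower _ _ hρ hρ0)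
    subst this
    exact hw0 ρ hρ hρ0
  · obtain ⟨-, ⟨z, π, hz, -⟩, -⟩ := key f hf hfext rfl subset_rfl
    exact hno z π hz

/-- The target has no children, so if it is the root, the tree is the root alone. -/
theorem Inv.eq_source_of_target_eq_source [Finite V] (hs : Inv P α s)
    (hst : P.target = P.source) {v : V} {τ : LRANode V} (hv : s.tree v = some τ) :
    v = P.source := by
  refine hs.tree_induction (motive := fun v _ => v = P.source) rfl ?_ v τ hv
  intro p σ v τ _ hv hp ih
  obtain ⟨-, -, -, hne, -⟩ := hs.of_parent hv hp
  exact absurd (ih.trans hst.symm) hne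

end LRAState

open LRAState in
theorem mainTheorem7 {V : Type*} [Finite V] (P : SPProblem V) (hP : P.NoTies)
    (α β : ℕ∞) (hβ : 1 < β) (hβα : β ≤ α) :
    LRAEvaluatedEdges P α 1 ⊆ LRAEvaluatedEdges P α β := by
  suffices h : ∀ k, ((step P α 1)^[k] (init P)).evaluated ⊆ LRAEvaluatedEdges P α β by
    rintro e ⟨k, hk⟩
    exact h k hk
  intro k
  induction k with
  | zero => exact Set.empty_subset _
  | succ k ih =>
    rw [Function.iterate_succ_apply']
    obtain ⟨hs, -⟩ := inv_iterate P α 1 k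
    set s := (step P α 1)^[k] (init P)
    rcases step_cases P α 1 s with ⟨-, h⟩ | ⟨-, ⟨o, ho, h⟩ | ⟨-, h⟩ | ⟨-, o, ho, h⟩ |
      ⟨-, hext, ⟨w, hw, h⟩ | ⟨-, h⟩⟩⟩ <;> rw [h] <;> try exact ih
    match htail : tail s.tree w with
    | [] => simpa [takeFirst, evaluateEdges] using ih
    | (u, v) :: es =>
      rw [takeFirst_one_cons]
      refine (evaluateEdges_singleton_subset P s (u, v)).trans (Set.insert_subset ?_ ih)
      -- If the target is the source, the root stays on the frontier with an empty tail and no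
      -- terminal state in the above sense is available; but then no edge is ever selected.
      by_cases hst : P.target = P.source
      · exfalso
        obtain ⟨τ, ⟨hτ, -⟩, -⟩ := hw
        obtain ⟨-, x, σ, -, -, hpath⟩ := hs.isBandPath_tail hτ
        rw [htail] at hpath
        obtain ⟨-, ⟨ρ, hρ, hp, -⟩, -⟩ := hpath
        exact hs.ne_source_of_parent hρ hp (hs.eq_source_of_target_eq_source hst hρ)
      · obtain ⟨f, hf, hfe, hterm⟩ := exists_terminal P (hβ.le.trans hβα) hβ.le hst
        rw [← hfe] at ih ⊢
        exact hs.mem_evaluated_of_terminal hP hext hf hterm ih hw htail
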